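/- Let $\Gamma$ be an arbitrary (discrete) group, and let $\Lambda$ be a (discrete) group satisfying the finiteness property $FP_\infty(\mathbb{Q})$, i.e. for every $n$ the trivial $\mathbb{Q}\Lambda$-module $\mathbb{Q}$ has a projective $\mathbb{Q}\Lambda$-resolution that is finitely generated in degrees up to $n$. Let $m\ge 1$ and suppose that $\Lambda$ has property $(T_m)$, i.e. $H^j(\Lambda,W)=0$ for every $1\le j\le m$ and every unitary representation $W$ of $\Lambda$ on a complex Hilbert space with $W^\Lambda=0$. Then for every unitary representation $V$ of $\Gamma\times\Lambda$ on a complex Hilbert space with $V^\Gamma=V^\Lambda=0$, one has \[ H^k(\Gamma\times\Lambda,V)=0\qquad\text{for all } k\in\{0,\dots,m+1\}. \] -/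

import Mathlib

open CategoryTheory

/-- A unitary representation of the (abstract, i.e. discrete) group `G` on the complex Hilbert
space `V`: a homomorphism from `G` to the group of surjective linear isometries of `V`. -/
abbrev UnitaryRep (G V : Type) [Group G] [NormedAddCommGroup V] [InnerProductSpace ℂ V] : Type :=
  G →* (V ≃ₗᵢ[ℂ] V)

namespace UnitaryRep

variable {G V : Type} [Group G] [NormedAddCommGroup V] [InnerProductSpace ℂ V]

/-- The `ℂ`-linear representation underlying a unitary representation. -/
def toRepresentation (π : UnitaryRep G V) : Representation ℂ G V where
  toFun g := (π g).toLinearEquiv.toLinearMap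
  map_one' := by
    ext v
    simp
  map_mul' g h := by
    ext v
    simp

/-- The subspace `V^G` of invariant vectors is zero. -/
def NoInvariants (π : UnitaryRep G V) : Prop :=
  π.toRepresentation.invariants = ⊥

/-- The group cohomology `H^k(G, V)` of `G` with coefficients in the unitary representation `V`
(no topology is involved in the cochains). -/
noncomputable abbrev cohomology (π : UnitaryRep G V) (k : ℕ) : ModuleCat ℂ :=
  groupCohomology (Rep.of π.toRepresentation) k

end UnitaryRep

/-- Property `(T_n)` of a group `G`: `H^j(G, V) = 0` for all `1 ≤ j ≤ n` and all unitary
representations of `G` on complex Hilbert spaces `V` without nonzero invariant vectors. -/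
def HigherPropertyT (n : ℕ) (G : Type) [Group G] : Prop :=
  ∀ (V : Type) [NormedAddCommGroup V] [InnerProductSpace ℂ V] [CompleteSpace V]
    (π : UnitaryRep G V), π.NoInvariants →
      ∀ j : ℕ, 1 ≤ j → j ≤ n → Subsingleton (π.cohomology j)

/-- The finiteness property `FP_n(ℚ)`: the trivial `ℚ[G]`-module `ℚ` has a projective resolution
whose terms are finitely generated `ℚ[G]`-modules in degrees up to `n`. -/
def FinitenessFP (n : ℕ) (G : Type) [Group G] : Prop :=
  ∃ P : ProjectiveResolution (Rep.trivial ℚ G ℚ),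
    ∀ i : ℕ, i ≤ n → Module.Finite (MonoidAlgebra ℚ G) (P.complex.X i).ρ.asModule

/-- The finiteness property `FP_∞(ℚ)`: `FP_n(ℚ)` for all `n`. -/
def FinitenessFPInfty (G : Type) [Group G] : Prop :=
  ∀ n : ℕ, FinitenessFP n G

/-! Since `V^Λ = 0`, property `(T_m)` gives `H^q(Λ, V) = 0` for all `q ≤ m`. Dimension shifting
through coinduction, in place of the Hochschild–Serre spectral sequence, yields `H^q(Γ × Λ, V) = 0`
for `q ≤ m` (`Rep.homExact_of_res`) and injectivity of the restriction `H^{m+1}(Γ × Λ, V) →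
H^{m+1}(Λ, V)` (`Rep.exists_d_comp_eq_of_res`). Restricted classes are `Γ`-invariant, so it remains
to kill invariant classes.

A resolution of `ℚ` over `Λ` that is finitely generated up to degree `m + 1` realises cochains as
closed subspaces of finite powers `V^r`. The coboundaries of degree `m + 1` are then closed
(`HigherPropertyT.exists_isClosed_coboundarySpace`): otherwise unit cochains of degree `m`,
orthogonal to coboundaries and with differential tending to zero, would define a cocycle in an
ultrapower of `V` that is not a coboundary, against `(T_m)` for the ultrapower. The ultrapower has
no invariant vectors because `H^0 = H^1 = 0` for `V` bounds the differential of degree `0` from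
below; here `m ≥ 1` enters.

Finally `Γ` acts isometrically on `V^r` and preserves coboundaries. The component of an invariant
class orthogonal to them is a `Γ`-fixed vector of `V^r`, hence zero
(`exists_d_comp_eq_of_isClosed`). -/

/-! ### Group cohomology as exactness of Hom complexes. -/

/-- Every `n`-cocycle of `Hom(X, A)` is a coboundary. In degree `0` the differential `X.d 0 0`
vanishes, so this says that every `0`-cocycle is zero. -/
def HomExact {C : Type*} [Category C] [Preadditive C] (X : ChainComplex C ℕ) (A : C) (n : ℕ) :
    Prop :=
  ∀ f : X.X n ⟶ A, X.d (n + 1) n ≫ f = 0 → ∃ g : X.X (n - 1) ⟶ A, X.d n (n - 1) ≫ g = f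

theorem homExact_zero_iff {C : Type*} [Category C] [Preadditive C] (X : ChainComplex C ℕ) (A : C) :
    HomExact X A 0 ↔ ∀ f : X.X 0 ⟶ A, X.d 1 0 ≫ f = 0 → f = 0 := by
  refine forall₂_congr fun f _ => ⟨?_, ?_⟩
  · rintro ⟨g, rfl⟩
    change X.d 0 0 ≫ g = 0
    simp
  · rintro rfl
    exact ⟨0, by simp⟩

theorem isZero_homology_linearYonedaObj_iff {C : Type*} [Category C] [Abelian C] {k : Type*}
    [Ring k] [Linear k C] (X : ChainComplex C ℕ) (A : C) (n : ℕ) :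
    Limits.IsZero ((X.linearYonedaObj k A).homology n) ↔ HomExact X A n := by
  rw [← HomologicalComplex.exactAt_iff_isZero_homology,
    -- In degree `0` the predecessor index is `0` itself, matching truncated subtraction.
    HomologicalComplex.exactAt_iff' _ (n - 1) n (n + 1) (by cases n <;> simp) (by simp),
    ShortComplex.moduleCat_exact_iff]
  rfl

/-- Any projective resolution may be used, so vanishing passes freely between the bar resolution,
its restriction to a factor, and a finitely generated resolution. -/
theorem subsingleton_groupCohomology_iff_homExact {k G : Type} [CommRing k] [Group G]
    (A : Rep.{0} k G) (n : ℕ) (P : ProjectiveResolution (Rep.trivial k G k)) :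
    Subsingleton (groupCohomology A n) ↔ HomExact P.complex A n := by
  rw [← isZero_homology_linearYonedaObj_iff (k := k), ← ModuleCat.isZero_iff_subsingleton]
  exact (groupCohomologyIso A n P).isZero_iff

/-- Inhomogeneous cochains are plain functions on powers of `G`, whatever the ring of scalars; this
form serves to compare `ℚ` with `ℂ`. -/
theorem subsingleton_groupCohomology_iff {k G : Type} [CommRing k] [Group G]
    (A : Rep.{0} k G) (n : ℕ) :
    Subsingleton (groupCohomology A n) ↔
      ∀ f : (Fin n → G) → A, (groupCohomology.inhomogeneousCochains A).d n (n + 1) f = 0 →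
        ∃ g : (Fin (n - 1) → G) → A,
          (groupCohomology.inhomogeneousCochains A).d (n - 1) n g = f := by
  rw [← ModuleCat.isZero_iff_subsingleton, groupCohomology,
    ← HomologicalComplex.exactAt_iff_isZero_homology,
    HomologicalComplex.exactAt_iff' _ (n - 1) n (n + 1) (by cases n <;> simp) (by simp),
    ShortComplex.moduleCat_exact_iff]
  rfl

theorem subsingleton_groupCohomology_zero_iff {k G : Type} [CommRing k] [Group G]
    (A : Rep.{0} k G) : Subsingleton (groupCohomology A 0) ↔ A.ρ.invariants = ⊥ := by
  rw [← ModuleCat.isZero_iff_subsingleton, (groupCohomology.H0Iso A).isZero_iff,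
    ModuleCat.isZero_iff_subsingleton]
  exact Submodule.subsingleton_iff_eq_bot

/-! ### Complex representations as rational ones. -/

section RestrictScalars

variable {G V W : Type} [Group G] [AddCommGroup V] [Module ℂ V] [AddCommGroup W] [Module ℂ W]

/-- A complex representation, regarded as a rational one. -/
noncomputable def Representation.ratRep (ρ : Representation ℂ G V) : Rep.{0} ℚ G :=
  letI : Module ℚ V := Module.compHom V (algebraMap ℚ ℂ)
  Rep.of (X := V)
    { toFun := fun g => (ρ g).toAddMonoidHom.toRatLinearMap
      map_one' := by ext v; simp
      map_mul' := fun g h => by ext v; simp }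

namespace Representation.ratRep

/-- An additive equivariant map into a complex representation is a morphism of rational
representations. -/
noncomputable def homMk (X : Rep.{0} ℚ G) (ρ : Representation ℂ G V) (f : X →+ V)
    (h : ∀ g x, f (X.ρ g x) = ρ g (f x)) : X ⟶ ρ.ratRep :=
  letI : Module ℚ V := Module.compHom V (algebraMap ℚ ℂ)
  Rep.ofHom (ρ := X.ρ) ⟨f.toRatLinearMap, fun g => by ext x; exact h g x⟩

/-- The additive map underlying a morphism into a complex representation. -/
noncomputable def eval {X : Rep.{0} ℚ G} {ρ : Representation ℂ G V} (f : X ⟶ ρ.ratRep) : X →+ V :=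
  f.hom.toLinearMap.toAddMonoidHom

theorem eval_apply {X : Rep.{0} ℚ G} {ρ : Representation ℂ G V} (f : X ⟶ ρ.ratRep) (x : X) :
    eval f x = f.hom x := rfl

theorem eval_ρ {X : Rep.{0} ℚ G} {ρ : Representation ℂ G V} (f : X ⟶ ρ.ratRep) (g : G) (x : X) :
    eval f (X.ρ g x) = ρ g (eval f x) := Rep.hom_comm_apply f g x

theorem eval_injective {X : Rep.{0} ℚ G} {ρ : Representation ℂ G V} :
    Function.Injective (eval : (X ⟶ ρ.ratRep) → (X →+ V)) := fun f g h => by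
  refine Rep.hom_ext (Representation.IntertwiningMap.ext (LinearMap.ext fun x => ?_))
  exact DFunLike.congr_fun h x

/-- The morphism of rational representations underlying an equivariant map of complex
representations. -/
noncomputable def map (ρ : Representation ℂ G V) (σ : Representation ℂ G W) (f : V →+ W)
    (h : ∀ g x, f (ρ g x) = σ g (f x)) : ρ.ratRep ⟶ σ.ratRep :=
  homMk ρ.ratRep σ f h

theorem eval_comp {X Y : Rep.{0} ℚ G} (ρ : Representation ℂ G V) (u : X ⟶ Y) (φ : Y ⟶ ρ.ratRep)
    (x : X) : eval (u ≫ φ) x = eval φ (u.hom x) := rfl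

theorem eval_sub {X : Rep.{0} ℚ G} {ρ : Representation ℂ G V} (f g : X ⟶ ρ.ratRep) :
    eval (f - g) = eval f - eval g := rfl

theorem inhomogeneousCochains_d (ρ : Representation ℂ G V) (n : ℕ) (f : (Fin n → G) → V)
    (x : Fin (n + 1) → G) :
    inhomogeneousCochains.d ρ.ratRep n f x = inhomogeneousCochains.d (Rep.of ρ) n f x := by
  refine (inhomogeneousCochains.d_hom_apply ρ.ratRep n f x).trans
    (Eq.trans ?_ (inhomogeneousCochains.d_hom_apply (Rep.of ρ) n f x).symm)
  refine congrArg₂ (· + ·) rfl (Finset.sum_congr rfl fun j _ => ?_)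
  change ((algebraMap ℚ ℂ) ((-1) ^ ((j : ℕ) + 1))) • (_ : V) = _
  simp

/-- Finiteness concerns `ℚ[G]`, unitary representations live over `ℂ`. The bridge is that the only
scalars in the differential are signs, so both cochain complexes have the same underlying maps. -/
theorem subsingleton_groupCohomology_iff (ρ : Representation ℂ G V) (n : ℕ) :
    Subsingleton (groupCohomology ρ.ratRep n) ↔ Subsingleton (groupCohomology (Rep.of ρ) n) := by
  have key (n : ℕ) (f : (Fin n → G) → V) :
      ((groupCohomology.inhomogeneousCochains ρ.ratRep).d n (n + 1) f :
        (Fin (n + 1) → G) → V) =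
      (groupCohomology.inhomogeneousCochains (Rep.of ρ)).d n (n + 1) f := by
    rw [groupCohomology.inhomogeneousCochains.d_def, groupCohomology.inhomogeneousCochains.d_def]
    exact funext (inhomogeneousCochains_d ρ n f)
  rw [_root_.subsingleton_groupCohomology_iff, _root_.subsingleton_groupCohomology_iff]
  refine forall_congr' fun f => imp_congr ?_ ?_
  · exact Eq.congr (key n f) rfl
  · refine exists_congr fun g => ?_
    cases n with
    | zero =>
      rw [HomologicalComplex.shape _ _ _ (by simp), HomologicalComplex.shape _ _ _ (by simp)]
      rfl
    | succ n => exact Eq.congr (key n g) rfl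

end Representation.ratRep

end RestrictScalars

/-! ### Coinduction from `Λ` to `Γ × Λ`. -/

theorem HomExact.of_retract {C : Type*} [Category C] [Preadditive C] {X : ChainComplex C ℕ}
    {A B : C} {n : ℕ} (h : HomExact X B n) (i : A ⟶ B) (p : B ⟶ A) (hip : i ≫ p = 𝟙 A) :
    HomExact X A n := fun f hf => by
  obtain ⟨g, hg⟩ := h (f ≫ i) (by rw [← Category.assoc, hf, Limits.zero_comp])
  refine ⟨g ≫ p, ?_⟩
  rw [← Category.assoc, hg, Category.assoc, hip, Category.comp_id]

namespace Rep

variable {k Γ Λ : Type} [CommRing k] [Group Γ] [Group Λ]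

/-- A coinduced function is freely prescribed on `Γ × 1` and extended by `Λ`-equivariance, so lifts
can be chosen pointwise there. -/
instance coindFunctor_inr_preservesEpimorphisms :
    (coindFunctor.{0} k (MonoidHom.inr Γ Λ)).PreservesEpimorphisms where
  preserves {X Y} f hf := by
    rw [epi_iff_surjective] at hf ⊢
    intro y
    choose s hs using hf
    refine ⟨⟨fun x => X.ρ x.2 (s (y.1 (x.1, 1))), fun g h => ?_⟩,
      Subtype.ext (funext fun x => ?_)⟩
    · change X.ρ (g * h.2) (s (y.1 (1 * h.1, 1))) = X.ρ g (X.ρ h.2 (s (y.1 (h.1, 1))))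
      simp
    · change f.hom (X.ρ x.2 (s (y.1 (x.1, 1)))) = y.1 x
      rw [hom_comm_apply, hs, ← y.2 x.2 (x.1, 1)]
      simp

instance resFunctor_inr_preservesProjectiveObjects :
    (resFunctor.{0} (k := k) (MonoidHom.inr Γ Λ)).PreservesProjectiveObjects :=
  (resFunctor (MonoidHom.inr Γ Λ)).preservesProjectiveObjects_of_adjunction_of_preservesEpimorphisms
    (resCoindAdjunction k (MonoidHom.inr Γ Λ))

section Coind

variable (A : Rep.{0} k Λ)

/-- Evaluation at `(γ, 1)`, as a map from the restriction to `Λ` of a representation coinduced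
from `Λ` to `Γ × Λ`. -/
noncomputable def coindEval (γ : Γ) :
    res (MonoidHom.inr Γ Λ) (coind (MonoidHom.inr Γ Λ) A) ⟶ A :=
  ofHom ⟨LinearMap.proj (γ, 1) ∘ₗ (A.ρ.coindV (MonoidHom.inr Γ Λ)).subtype, fun l => by
    refine LinearMap.ext fun y => ?_
    have h : y.1 (γ * 1, 1 * l) = A.ρ l (y.1 (γ, 1)) := by simpa using y.2 l (γ, 1)
    exact h⟩

variable {A}

/-- A family of maps indexed by `Γ` assembles to a map into the restriction to `Λ` of a
representation coinduced from `Λ` to `Γ × Λ`. -/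
noncomputable def coindPi {X : Rep.{0} k Λ} (g : Γ → (X ⟶ A)) :
    X ⟶ res (MonoidHom.inr Γ Λ) (coind (MonoidHom.inr Γ Λ) A) :=
  ofHom ⟨(LinearMap.pi fun x => A.ρ x.2 ∘ₗ (g x.1).hom.toLinearMap).codRestrict _
    fun x l y => by simp, fun l => by
      refine LinearMap.ext fun x => Subtype.ext (funext fun y => ?_)
      change A.ρ y.2 ((g y.1).hom (X.ρ l x)) = A.ρ (y.2 * l) ((g (y.1 * 1)).hom x)
      rw [hom_comm_apply]
      simp⟩

theorem coindPi_eval {X : Rep.{0} k Λ} (g : Γ → (X ⟶ A)) (γ : Γ) :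
    coindPi g ≫ coindEval A γ = g γ := by
  refine hom_ext (Representation.IntertwiningMap.ext (LinearMap.ext fun x => ?_))
  change A.ρ 1 ((g γ).hom x) = (g γ).hom x
  simp

theorem coind_hom_ext {X : Rep.{0} k Λ}
    {f g : X ⟶ res (MonoidHom.inr Γ Λ) (coind (MonoidHom.inr Γ Λ) A)}
    (h : ∀ γ, f ≫ coindEval A γ = g ≫ coindEval A γ) : f = g := by
  refine hom_ext (Representation.IntertwiningMap.ext (LinearMap.ext fun x => ?_))
  refine Subtype.ext (funext fun y => ?_)
  have h1 : (f.hom x).1 (y.1, 1) = (g.hom x).1 (y.1, 1) :=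
    congr($(congrArg Hom.hom (h y.1)) x)
  have h2 := (f.hom x).2 y.2 (y.1, 1)
  have h3 := (g.hom x).2 y.2 (y.1, 1)
  rw [h1] at h2
  simpa using h2.trans h3.symm

/-- Over `Λ` the coinduced module is the product of copies of `A` indexed by `Γ`, with projections
`coindEval`; primitives are chosen in each factor. -/
theorem homExact_res_coind {X : ChainComplex (Rep.{0} k Λ) ℕ} {n : ℕ} (h : HomExact X A n) :
    HomExact X (res (MonoidHom.inr Γ Λ) (coind (MonoidHom.inr Γ Λ) A)) n := fun f hf => by
  choose g hg using fun γ => h (f ≫ coindEval A γ) (by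
    rw [← Category.assoc, hf, Limits.zero_comp])
  refine ⟨coindPi g, coind_hom_ext fun γ => ?_⟩
  rw [Category.assoc, coindPi_eval, hg]

end Coind

section Unit

variable (A : Rep.{0} k (Γ × Λ))

/-- The unit of the adjunction between restriction to `Λ` and coinduction. -/
noncomputable def coindUnit : A ⟶ coind (MonoidHom.inr Γ Λ) (res (MonoidHom.inr Γ Λ) A) :=
  resCoindToHom (MonoidHom.inr Γ Λ) A (res (MonoidHom.inr Γ Λ) A) (𝟙 _)

theorem resMap_coindUnit_eval :
    (resFunctor (MonoidHom.inr Γ Λ)).map (coindUnit A) ≫ coindEval _ 1 = 𝟙 _ := by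
  refine hom_ext (Representation.IntertwiningMap.ext (LinearMap.ext fun x => ?_))
  change A.ρ 1 x = x
  simp

instance : Mono (coindUnit A) := by
  rw [mono_iff_injective]
  intro x y hxy
  have h (z : A) : ((coindUnit A).hom z).1 1 = z := by
    change A.ρ 1 z = z
    simp
  rw [← h x, ← h y, hxy]

/-- The cokernel of the unit of the adjunction between restriction to `Λ` and coinduction. -/
noncomputable abbrev coindQuotient : Rep.{0} k (Γ × Λ) := Limits.cokernel (coindUnit A)

/-- Evaluation at `1` splits the unit over `Λ`, though not over `Γ × Λ`; hence the quotient is a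
`Λ`-summand of the coinduced module and inherits exactness over `Λ`. -/
theorem coindQuotient_isRetract :
    ∃ (i : res (MonoidHom.inr Γ Λ) (coindQuotient A) ⟶
        res (MonoidHom.inr Γ Λ) (coind (MonoidHom.inr Γ Λ) (res (MonoidHom.inr Γ Λ) A)))
      (p : res (MonoidHom.inr Γ Λ) (coind (MonoidHom.inr Γ Λ) (res (MonoidHom.inr Γ Λ) A)) ⟶
        res (MonoidHom.inr Γ Λ) (coindQuotient A)), i ≫ p = 𝟙 _ := by
  let F := resFunctor.{0} (k := k) (MonoidHom.inr Γ Λ)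
  let S : ShortComplex (Rep.{0} k (Γ × Λ)) :=
    ShortComplex.mk (coindUnit A) (Limits.cokernel.π (coindUnit A)) (by simp)
  have hS : (S.map F).Exact := (res_map_exact _ S).2 (ShortComplex.exact_cokernel _)
  have hg : Epi (S.map F).g := by
    rw [epi_iff_surjective]
    exact (epi_iff_surjective S.g).1 (inferInstanceAs (Epi (Limits.cokernel.π (coindUnit A))))
  exact ⟨_, _, (ShortComplex.Splitting.ofExactOfRetraction (S.map F) hS (coindEval _ 1)
    (resMap_coindUnit_eval A) hg).s_g⟩

theorem homExact_res_coindQuotient {X : ChainComplex (Rep.{0} k Λ) ℕ} {n : ℕ}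
    (h : HomExact X (res (MonoidHom.inr Γ Λ) A) n) :
    HomExact X (res (MonoidHom.inr Γ Λ) (coindQuotient A)) n := by
  obtain ⟨i, p, hip⟩ := coindQuotient_isRetract A
  exact (homExact_res_coind h).of_retract i p hip

end Unit

/-! ### Dimension shifting from `Λ` to `Γ × Λ`. -/

section Descent

/-- Restriction of a complex of representations from `Γ × Λ` to `Λ`. -/
noncomputable abbrev resComplex (Q : ChainComplex (Rep.{0} k (Γ × Λ)) ℕ) :
    ChainComplex (Rep.{0} k Λ) ℕ :=
  ((resFunctor (MonoidHom.inr Γ Λ)).mapHomologicalComplex _).obj Q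

variable {Q : ChainComplex (Rep.{0} k (Γ × Λ)) ℕ}

/-- By adjunction a primitive of `f` over `Λ` is an equivariant primitive `g'` with coinduced
values. Modulo `A` it is a cocycle, hence a coboundary; lifting a primitive by projectivity and
subtracting its differential moves `g'` into `A`. -/
theorem exists_d_comp_eq_of_homExact_coindQuotient (hQ : ∀ n, Projective (Q.X n))
    {A : Rep.{0} k (Γ × Λ)} {n : ℕ}
    (h : HomExact Q (coindQuotient A) n) (f : Q.X (n + 1) ⟶ A)
    (hf : ∃ g : res (MonoidHom.inr Γ Λ) (Q.X n) ⟶ res (MonoidHom.inr Γ Λ) A,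
      (resFunctor (MonoidHom.inr Γ Λ)).map (Q.d (n + 1) n) ≫ g =
        (resFunctor (MonoidHom.inr Γ Λ)).map f) :
    ∃ g : Q.X n ⟶ A, Q.d (n + 1) n ≫ g = f := by
  obtain ⟨g, hg⟩ := hf
  let g' : Q.X n ⟶ coind (MonoidHom.inr Γ Λ) (res (MonoidHom.inr Γ Λ) A) :=
    resCoindToHom (MonoidHom.inr Γ Λ) _ _ g
  have hg' : Q.d (n + 1) n ≫ g' = f ≫ coindUnit A := by
    refine hom_ext (Representation.IntertwiningMap.ext (LinearMap.ext fun x => ?_))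
    refine Subtype.ext (funext fun y => ?_)
    change g.hom ((Q.X n).ρ y ((Q.d (n + 1) n).hom x)) = A.ρ y (f.hom x)
    rw [← hom_comm_apply, ← hom_comm_apply]
    exact congr($(congrArg Hom.hom hg) ((Q.X (n + 1)).ρ y x))
  obtain ⟨h₁, hh₁⟩ := h (g' ≫ Limits.cokernel.π (coindUnit A)) (by
    rw [← Category.assoc, hg', Category.assoc, Limits.cokernel.condition, Limits.comp_zero])
  have := hQ (n - 1)
  let h₂ := Projective.factorThru h₁ (Limits.cokernel.π (coindUnit A))
  have hh₂ : h₂ ≫ Limits.cokernel.π (coindUnit A) = h₁ := Projective.factorThru_comp _ _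
  let S : ShortComplex (Rep.{0} k (Γ × Λ)) :=
    ShortComplex.mk (coindUnit A) (Limits.cokernel.π (coindUnit A)) (by simp)
  have hS : S.Exact := ShortComplex.exact_cokernel _
  have : Mono S.f := inferInstanceAs (Mono (coindUnit A))
  have hz : (g' - Q.d n (n - 1) ≫ h₂) ≫ S.g = 0 := by
    change (g' - Q.d n (n - 1) ≫ h₂) ≫ Limits.cokernel.π (coindUnit A) = 0
    rw [Preadditive.sub_comp, Category.assoc, hh₂, hh₁, sub_self]
  refine ⟨hS.lift _ hz, ?_⟩
  rw [← cancel_mono S.f, Category.assoc, hS.lift_f, Preadditive.comp_sub, hg', ← Category.assoc,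
    Q.d_comp_d]
  simp [S]

/-- If `Hom_Λ(Q, A)` is exact in degrees up to `n`, then `Hom_{Γ × Λ}(Q, A)` is exact in
degree `n`. -/
theorem homExact_of_res (hQ : ∀ n, Projective (Q.X n)) (n : ℕ) (A : Rep.{0} k (Γ × Λ))
    (h : ∀ q ≤ n, HomExact (resComplex Q) (res (MonoidHom.inr Γ Λ) A) q) : HomExact Q A n := by
  induction n generalizing A with
  | zero =>
    rw [homExact_zero_iff]
    intro f hf
    refine (resFunctor (MonoidHom.inr Γ Λ)).map_injective ?_
    rw [Functor.map_zero]
    refine (homExact_zero_iff _ _).1 (h 0 le_rfl) _ ?_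
    change (resFunctor (MonoidHom.inr Γ Λ)).map (Q.d 1 0) ≫
      (resFunctor (MonoidHom.inr Γ Λ)).map f = 0
    rw [← Functor.map_comp, hf, Functor.map_zero]
  | succ n ih =>
    intro f hf
    refine exists_d_comp_eq_of_homExact_coindQuotient hQ
      (ih _ fun q hq => homExact_res_coindQuotient A (h q (by omega))) f ?_
    refine h (n + 1) le_rfl ((resFunctor (MonoidHom.inr Γ Λ)).map f) ?_
    change (resFunctor (MonoidHom.inr Γ Λ)).map (Q.d (n + 2) (n + 1)) ≫
      (resFunctor (MonoidHom.inr Γ Λ)).map f = 0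
    rw [← Functor.map_comp, hf, Functor.map_zero]

/-- If `Hom_Λ(Q, A)` is exact in degrees up to `n`, then a `Γ × Λ`-equivariant cochain of degree
`n + 1` that is a coboundary over `Λ` is a coboundary over `Γ × Λ`. -/
theorem exists_d_comp_eq_of_res (hQ : ∀ n, Projective (Q.X n)) (n : ℕ) (A : Rep.{0} k (Γ × Λ))
    (h : ∀ q ≤ n, HomExact (resComplex Q) (res (MonoidHom.inr Γ Λ) A) q)
    (f : Q.X (n + 1) ⟶ A)
    (hf : ∃ g : res (MonoidHom.inr Γ Λ) (Q.X n) ⟶ res (MonoidHom.inr Γ Λ) A,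
      (resFunctor (MonoidHom.inr Γ Λ)).map (Q.d (n + 1) n) ≫ g =
        (resFunctor (MonoidHom.inr Γ Λ)).map f) :
    ∃ g : Q.X n ⟶ A, Q.d (n + 1) n ≫ g = f :=
  exists_d_comp_eq_of_homExact_coindQuotient hQ
    (homExact_of_res hQ n _ fun q hq => homExact_res_coindQuotient A (h q hq)) f hf

end Descent

end Rep

/-! ### Ultrapowers of unitary representations. -/

section Ultrapower

open Filter Topology
open scoped BoundedContinuousFunction

variable (ω : Ultrafilter ℕ) (V : Type) [NormedAddCommGroup V] [InnerProductSpace ℂ V]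

/-- The bounded sequences in `V` that converge to zero along the ultrafilter `ω`. -/
def nullSequences : Submodule ℂ (ℕ →ᵇ V) where
  carrier := {f | Tendsto (fun n => f n) ω (𝓝 0)}
  add_mem' {f g} hf hg := by simpa using Tendsto.add hf hg
  zero_mem' := tendsto_const_nhds
  smul_mem' c f hf := by simpa using Tendsto.const_smul hf c

variable {ω V} in
theorem mem_nullSequences {f : ℕ →ᵇ V} :
    f ∈ nullSequences ω V ↔ Tendsto (fun n => f n) ω (𝓝 0) := Iff.rfl

instance : IsClosed (nullSequences ω V : Set (ℕ →ᵇ V)) := by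
  refine isClosed_of_closure_subset fun f hf => ?_
  rw [Metric.mem_closure_iff] at hf
  refine mem_nullSequences.2 (NormedAddGroup.tendsto_nhds_zero.2 fun ε hε => ?_)
  obtain ⟨g, hg, hfg⟩ := hf (ε / 2) (half_pos hε)
  filter_upwards [NormedAddGroup.tendsto_nhds_zero.1 (mem_nullSequences.1 hg) (ε / 2)
    (half_pos hε)] with n hn
  have h1 : ‖f n - g n‖ < ε / 2 := by
    rw [← dist_eq_norm]
    exact (BoundedContinuousFunction.dist_coe_le_dist n).trans_lt hfg
  calc ‖f n‖ = ‖(f n - g n) + g n‖ := by simp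
    _ ≤ ‖f n - g n‖ + ‖g n‖ := norm_add_le _ _
    _ < ε := by linarith

/-- The ultrapower of the Hilbert space `V`: bounded sequences modulo those that converge to zero
along the ultrafilter. -/
abbrev Ultrapower : Type := (ℕ →ᵇ V) ⧸ nullSequences ω V

namespace Ultrapower

variable {V}

/-- The class in the ultrapower of a bounded sequence. -/
noncomputable abbrev mk : (ℕ →ᵇ V) →ₗ[ℂ] Ultrapower ω V := (nullSequences ω V).mkQ

theorem mk_eq_zero_iff {f : ℕ →ᵇ V} : mk ω f = 0 ↔ Tendsto (fun n => f n) ω (𝓝 0) := by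
  rw [Submodule.mkQ_apply, Submodule.Quotient.mk_eq_zero, mem_nullSequences]

/-- For `≤`, the entries of norm above `L + ε` are replaced by zero, which does not change the
class. For `≥`, a representative of almost minimal norm bounds the limit. -/
theorem tendsto_norm (f : ℕ →ᵇ V) : Tendsto (fun n => ‖f n‖) ω (𝓝 ‖mk ω f‖) := by
  obtain ⟨L, -, hL⟩ := (isCompact_Icc (a := (0 : ℝ)) (b := ‖f‖)).ultrafilter_le_nhds
    (ω.map fun n => ‖f n‖) (by
      rw [le_principal_iff]
      exact mem_map.2 (Eventually.of_forall fun n => ⟨norm_nonneg _, f.norm_coe_le_norm n⟩))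
  have hL : Tendsto (fun n => ‖f n‖) ω (𝓝 L) := hL
  suffices h : ‖mk ω f‖ = L by rwa [h]
  refine le_antisymm (le_of_forall_pos_le_add fun ε hε => ?_)
    (le_of_forall_pos_le_add fun ε hε => ?_)
  · classical
    have hA : ∀ᶠ n in ω, ‖f n‖ ≤ L + ε :=
      (hL.eventually (gt_mem_nhds (lt_add_of_pos_right L hε))).mono fun n hn => hn.le
    have hL0 : 0 ≤ L := ge_of_tendsto' hL fun n => norm_nonneg _
    have hb (n : ℕ) : ‖if ‖f n‖ ≤ L + ε then f n else 0‖ ≤ L + ε := by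
      split_ifs with h
      · exact h
      · simpa using (by positivity : 0 ≤ L + ε)
    let g : ℕ →ᵇ V := BoundedContinuousFunction.ofNormedAddCommGroupDiscrete
      (fun n => if ‖f n‖ ≤ L + ε then f n else 0) (L + ε) hb
    have hg : mk ω f = mk ω g := by
      rw [← sub_eq_zero, ← map_sub, mk_eq_zero_iff]
      refine tendsto_const_nhds.congr' ?_
      filter_upwards [hA] with n hn
      change 0 = f n - if ‖f n‖ ≤ L + ε then f n else 0
      rw [if_pos hn, sub_self]
    rw [hg]
    exact (Submodule.Quotient.norm_mk_le _ g).trans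
      ((BoundedContinuousFunction.norm_le (by positivity)).2 hb)
  · obtain ⟨g, hg, hgn⟩ := Submodule.Quotient.norm_mk_lt (mk ω f) hε
    have h0 : Tendsto (fun n => ‖(f - g) n‖ + (‖mk ω f‖ + ε)) ω (𝓝 (0 + (‖mk ω f‖ + ε))) := by
      refine Tendsto.add ?_ tendsto_const_nhds
      refine tendsto_zero_iff_norm_tendsto_zero.1 ((mk_eq_zero_iff ω).1 ?_)
      rw [map_sub, sub_eq_zero]
      exact hg.symm
    rw [zero_add] at h0
    refine le_of_tendsto_of_tendsto' hL h0 fun n => ?_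
    calc ‖f n‖ = ‖(f - g) n + g n‖ := by simp
      _ ≤ ‖(f - g) n‖ + ‖g n‖ := norm_add_le _ _
      _ ≤ _ := by gcongr; exact (g.norm_coe_le_norm n).trans hgn.le

/-- The parallelogram law holds at each index and passes to the limit along `ω`. -/
noncomputable instance : InnerProductSpace ℂ (Ultrapower ω V) := InnerProductSpace.ofNorm ℂ <| by
  intro x y
  obtain ⟨f, rfl⟩ := (nullSequences ω V).mkQ_surjective x
  obtain ⟨g, rfl⟩ := (nullSequences ω V).mkQ_surjective y
  rw [← map_add, ← map_sub]
  have h1 := (tendsto_norm ω (f + g)).mul (tendsto_norm ω (f + g))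
  have h2 := (tendsto_norm ω (f - g)).mul (tendsto_norm ω (f - g))
  have h3 := (tendsto_norm ω f).mul (tendsto_norm ω f)
  have h4 := (tendsto_norm ω g).mul (tendsto_norm ω g)
  refine tendsto_nhds_unique (h1.add h2) (((h3.add h4).const_mul 2).congr fun n => ?_)
  have h := parallelogram_law_with_norm ℂ (f n) (g n)
  simp only [sq] at h
  exact h.symm

end Ultrapower

/-- A representation by isometries is a unitary representation. -/
def UnitaryRep.ofIsometric {G V : Type} [Group G] [NormedAddCommGroup V] [InnerProductSpace ℂ V]
    (ρ : Representation ℂ G V) (h : ∀ g v, ‖ρ g v‖ = ‖v‖) : UnitaryRep G V where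
  toFun g := LinearIsometryEquiv.mk
    (LinearEquiv.ofLinearMap (ρ g) (ρ g⁻¹) (by ext v; simp) (by ext v; simp)) (h g)
  map_one' := by ext v; simp
  map_mul' g g' := by ext v; simp; rfl

variable {V} {G : Type} [Group G] (π : UnitaryRep G V)

/-- The representation of `G` on bounded sequences of vectors of a unitary representation. -/
noncomputable def UnitaryRep.boundedSeq : Representation ℂ G (ℕ →ᵇ V) where
  toFun g := (ContinuousLinearMap.compLeftContinuousBounded ℕ
    (π g).toContinuousLinearEquiv.toContinuousLinearMap).toLinearMap
  map_one' := by ext; simp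
  map_mul' g h := by ext; simp

/-- The representation of `G` on the ultrapower of a unitary representation. -/
noncomputable def UnitaryRep.ultrapowerRep : Representation ℂ G (Ultrapower ω V) :=
  π.boundedSeq.quotient (nullSequences ω V) fun g f hf => by
    refine mem_nullSequences.2 (tendsto_zero_iff_norm_tendsto_zero.2 ?_)
    refine (tendsto_zero_iff_norm_tendsto_zero.1 (mem_nullSequences.1 hf)).congr fun n => ?_
    exact ((π g).norm_map (f n)).symm

/-- The unitary representation of `G` on the ultrapower of a unitary representation. -/
noncomputable def UnitaryRep.ultrapower : UnitaryRep G (Ultrapower ω V) :=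
  ofIsometric (π.ultrapowerRep ω) fun g v => by
    obtain ⟨f, rfl⟩ := (nullSequences ω V).mkQ_surjective v
    refine tendsto_nhds_unique (Ultrapower.tendsto_norm ω (π.boundedSeq g f))
      ((Ultrapower.tendsto_norm ω f).congr fun n => ?_)
    exact ((π g).norm_map (f n)).symm

end Ultrapower

/-! ### Cochains on finitely generated modules as closed subspaces of `V^r`. -/

section GroupRingAction

variable {G V : Type} [Group G] [NormedAddCommGroup V] [InnerProductSpace ℂ V]
  (π : UnitaryRep G V)

/-- The operator by which an element of the rational group ring acts on a unitary
representation. -/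
noncomputable def UnitaryRep.groupRingAct : MonoidAlgebra ℚ G →+* (V →L[ℂ] V) :=
  (MonoidAlgebra.lift ℂ (V →L[ℂ] V) G
    { toFun := fun g => (π g).toContinuousLinearEquiv.toContinuousLinearMap
      map_one' := by ext v; simp
      map_mul' := fun g h => by ext v; simp }).toRingHom.comp
    (MonoidAlgebra.mapRingHom G (algebraMap ℚ ℂ))

theorem UnitaryRep.groupRingAct_single (g : G) (c : ℚ) (v : V) :
    π.groupRingAct (MonoidAlgebra.single g c) v = (c : ℂ) • π g v := by
  simp [groupRingAct]

open Representation.ratRep in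
theorem UnitaryRep.eval_asAlgebraHom {X : Rep.{0} ℚ G} (f : X ⟶ π.toRepresentation.ratRep)
    (a : MonoidAlgebra ℚ G) (x : X) :
    eval f (X.ρ.asAlgebraHom a x) = π.groupRingAct a (eval f x) := by
  induction a using MonoidAlgebra.induction_linear with
  | zero => simp
  | add a b ha hb => simp [ha, hb]
  | single g c =>
    rw [Representation.asAlgebraHom_single, groupRingAct_single, LinearMap.smul_apply,
      eval_apply, map_smul, ← eval_apply, eval_ρ]
    rfl

end GroupRingAction

namespace Rep

variable {G : Type} [Group G] {X : Rep.{0} ℚ G} {r : ℕ}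

/-- The linear combination of the elements `s i` of a rational representation with coefficients
in the group ring. -/
noncomputable def groupRingComb (s : Fin r → X) (a : Fin r → MonoidAlgebra ℚ G) : X :=
  ∑ i, X.ρ.asAlgebraHom (a i) (s i)

theorem groupRingComb_sub (s : Fin r → X) (a b : Fin r → MonoidAlgebra ℚ G) :
    groupRingComb s (a - b) = groupRingComb s a - groupRingComb s b := by
  simp [groupRingComb, Finset.sum_sub_distrib]

theorem groupRingComb_add (s : Fin r → X) (a b : Fin r → MonoidAlgebra ℚ G) :
    groupRingComb s (a + b) = groupRingComb s a + groupRingComb s b := by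
  simp [groupRingComb, Finset.sum_add_distrib]

theorem groupRingComb_single_mul (s : Fin r → X) (a : Fin r → MonoidAlgebra ℚ G) (g : G) :
    groupRingComb s (fun i => MonoidAlgebra.single g 1 * a i) = X.ρ g (groupRingComb s a) := by
  simp [groupRingComb]

/-- The elements `s i` generate the representation `X` as a module over the group ring. -/
def IsGenerating (s : Fin r → X) : Prop := Function.Surjective (groupRingComb s)

theorem exists_isGenerating [Module.Finite (MonoidAlgebra ℚ G) X.ρ.asModule] :
    ∃ (r : ℕ) (s : Fin r → X), IsGenerating s := by
  obtain ⟨r, s, hs⟩ := Module.Finite.exists_fin (R := MonoidAlgebra ℚ G) (M := X.ρ.asModule)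
  refine ⟨r, fun i => X.ρ.asModuleEquiv (s i), fun x => ?_⟩
  have hx : X.ρ.asModuleEquiv.symm x ∈ Submodule.span (MonoidAlgebra ℚ G) (Set.range s) := by
    rw [hs]
    trivial
  obtain ⟨a, ha⟩ := (Submodule.mem_span_range_iff_exists_fun _).1 hx
  refine ⟨a, ?_⟩
  have h := congrArg X.ρ.asModuleEquiv ha
  rw [map_sum] at h
  simpa [groupRingComb, Representation.asModuleEquiv_map_smul] using h

end Rep

section CochainVec

open Representation.ratRep Rep

variable {G V : Type} [Group G] [NormedAddCommGroup V] [InnerProductSpace ℂ V]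
  {π : UnitaryRep G V} {X : Rep.{0} ℚ G} {r : ℕ}

/-- The values of a cochain on a finite family, as a vector of a Hilbert space. -/
noncomputable def cochainVec (s : Fin r → X) (f : X ⟶ π.toRepresentation.ratRep) :
    PiLp 2 (fun _ : Fin r => V) :=
  WithLp.toLp 2 fun i => eval f (s i)

theorem cochainVec_apply (s : Fin r → X) (f : X ⟶ π.toRepresentation.ratRep) (i : Fin r) :
    cochainVec s f i = eval f (s i) := rfl

theorem cochainVec_sub (s : Fin r → X) (f g : X ⟶ π.toRepresentation.ratRep) :
    cochainVec s (f - g) = cochainVec s f - cochainVec s g := rfl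

theorem cochainVec_zero (s : Fin r → X) :
    cochainVec s (0 : X ⟶ π.toRepresentation.ratRep) = 0 := rfl

theorem eval_groupRingComb (s : Fin r → X) (f : X ⟶ π.toRepresentation.ratRep)
    (a : Fin r → MonoidAlgebra ℚ G) :
    eval f (groupRingComb s a) = ∑ i, π.groupRingAct (a i) (eval f (s i)) := by
  simp [groupRingComb, map_sum, π.eval_asAlgebraHom]

theorem cochainVec_injective {s : Fin r → X} (hs : IsGenerating s) :
    Function.Injective (cochainVec s : (X ⟶ π.toRepresentation.ratRep) → _) := by
  intro f g hfg
  refine eval_injective (AddMonoidHom.ext fun x => ?_)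
  obtain ⟨a, rfl⟩ := hs x
  rw [eval_groupRingComb, eval_groupRingComb]
  refine Finset.sum_congr rfl fun i _ => ?_
  rw [← cochainVec_apply, ← cochainVec_apply, hfg]

/-- Multiplication of a cochain by a complex number. -/
noncomputable def smulCochain (c : ℂ) (f : X ⟶ π.toRepresentation.ratRep) :
    X ⟶ π.toRepresentation.ratRep :=
  f ≫ map π.toRepresentation π.toRepresentation (DistribSMul.toAddMonoidHom V c)
    fun g x => (map_smul (π.toRepresentation g) c x).symm

theorem cochainVec_smulCochain (s : Fin r → X) (c : ℂ) (f : X ⟶ π.toRepresentation.ratRep) :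
    cochainVec s (smulCochain c f) = c • cochainVec s f := rfl

theorem comp_smulCochain {Y : Rep.{0} ℚ G} (d : Y ⟶ X) (c : ℂ)
    (f : X ⟶ π.toRepresentation.ratRep) : d ≫ smulCochain c f = smulCochain c (d ≫ f) := by
  rw [smulCochain, smulCochain, Category.assoc]

variable (π) in
/-- The space of cochains, identified with their values on a finite family. -/
noncomputable def cochainSpace (s : Fin r → X) : Submodule ℂ (PiLp 2 (fun _ : Fin r => V)) where
  carrier := Set.range (cochainVec s : (X ⟶ π.toRepresentation.ratRep) → _)
  add_mem' := by
    rintro _ _ ⟨f, rfl⟩ ⟨g, rfl⟩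
    exact ⟨f + g, rfl⟩
  zero_mem' := ⟨0, rfl⟩
  smul_mem' := by
    rintro c _ ⟨f, rfl⟩
    exact ⟨smulCochain c f, rfl⟩

theorem cochainVec_mem (s : Fin r → X) (f : X ⟶ π.toRepresentation.ratRep) :
    cochainVec s f ∈ cochainSpace π s := ⟨f, rfl⟩

/-- A cochain is a choice of values on the generators that respects every relation. Each relation is
a bounded linear condition, so closedness needs generators only, not finitely many relations. -/
theorem mem_cochainSpace_iff {s : Fin r → X} (hs : IsGenerating s)
    {x : PiLp 2 (fun _ : Fin r => V)} :
    x ∈ cochainSpace π s ↔ ∀ a : Fin r → MonoidAlgebra ℚ G, groupRingComb s a = 0 →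
      ∑ i, π.groupRingAct (a i) (x i) = 0 := by
  refine ⟨?_, fun h => ?_⟩
  · rintro ⟨f, rfl⟩ a ha
    have := eval_groupRingComb s f a
    rw [ha, map_zero] at this
    exact this.symm
  · choose a ha using hs
    have key (b c : Fin r → MonoidAlgebra ℚ G) (hbc : groupRingComb s b = groupRingComb s c) :
        ∑ i, π.groupRingAct (b i) (x i) = ∑ i, π.groupRingAct (c i) (x i) := by
      have := h (b - c) (by rw [groupRingComb_sub, hbc, sub_self])
      rw [← sub_eq_zero, ← this, ← Finset.sum_sub_distrib]
      simp
    refine ⟨homMk X π.toRepresentation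
      { toFun := fun y => ∑ i, π.groupRingAct (a y i) (x i)
        map_zero' := h _ (ha 0)
        map_add' := fun y z => ?_ } fun g y => ?_, ?_⟩
    · rw [key (a (y + z)) (a y + a z) (by rw [groupRingComb_add, ha, ha, ha]),
        ← Finset.sum_add_distrib]
      simp
    · change ∑ i, π.groupRingAct (a (X.ρ g y) i) (x i) =
        π g (∑ i, π.groupRingAct (a y i) (x i))
      rw [key (a (X.ρ g y)) (fun i => MonoidAlgebra.single g 1 * a y i)
        (by rw [groupRingComb_single_mul, ha, ha]), map_sum]
      refine Finset.sum_congr rfl fun i _ => ?_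
      rw [map_mul, mul_apply_eq_comp, π.groupRingAct_single]
      simp
    · ext j
      change ∑ i, π.groupRingAct (a (s j) i) (x i) = x j
      rw [key (a (s j)) (Pi.single j 1) ?_]
      · rw [Finset.sum_eq_single j (fun i _ hi => by simp [hi]) (by simp)]
        simp
      · rw [ha, groupRingComb, Finset.sum_eq_single j (fun i _ hi => by simp [hi]) (by simp)]
        simp

theorem isClosed_cochainSpace {s : Fin r → X} (hs : IsGenerating s) :
    IsClosed (cochainSpace π s : Set (PiLp 2 (fun _ : Fin r => V))) := by
  have h : (cochainSpace π s : Set (PiLp 2 (fun _ : Fin r => V))) =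
      ⋂ (a : Fin r → MonoidAlgebra ℚ G) (_ : groupRingComb s a = 0),
        {x | ∑ i, π.groupRingAct (a i) (x i) = 0} := by
    ext x
    simp only [SetLike.mem_coe, mem_cochainSpace_iff hs, Set.mem_iInter, Set.mem_ofPred_eq]
  rw [h]
  refine isClosed_iInter fun a => isClosed_iInter fun _ => isClosed_eq ?_ continuous_const
  fun_prop

/-- The coboundary operator, extended to a bounded operator between the ambient Hilbert
spaces. -/
theorem exists_coboundary_operator (π : UnitaryRep G V) {Y : Rep.{0} ℚ G} {r' : ℕ} (d : Y ⟶ X)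
    {s : Fin r → X} (hs : IsGenerating s) (t : Fin r' → Y) :
    ∃ D : PiLp 2 (fun _ : Fin r => V) →L[ℂ] PiLp 2 (fun _ : Fin r' => V),
      ∀ f : X ⟶ π.toRepresentation.ratRep, D (cochainVec s f) = cochainVec t (d ≫ f) := by
  -- The differentials of the `t j` are group-ring combinations of the `s i`; this matrix acts on
  -- all of `V^r`.
  choose a ha using fun j => hs (d.hom (t j))
  refine ⟨(PiLp.continuousLinearEquiv 2 ℂ (fun _ : Fin r' => V)).symm.toContinuousLinearMap ∘L
    ContinuousLinearMap.pi fun j => ∑ i, π.groupRingAct (a j i) ∘L PiLp.proj 2 _ i,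
    fun f => ?_⟩
  ext j
  rw [cochainVec_apply, eval_comp, ← ha j, eval_groupRingComb]
  simp [cochainVec_apply]

end CochainVec

/-! ### Ultrapower cochains and lower bounds for the coboundary. -/

section UltrapowerCochains

open Representation.ratRep Rep Filter Topology
open scoped BoundedContinuousFunction

variable {G V : Type} [Group G] [NormedAddCommGroup V] [InnerProductSpace ℂ V]
  (π : UnitaryRep G V) (ω : Ultrafilter ℕ) {X : Rep.{0} ℚ G}

/-- The projection from bounded sequences to the ultrapower. -/
noncomputable def ultrapowerMk :
    π.boundedSeq.ratRep ⟶ (π.ultrapower ω).toRepresentation.ratRep :=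
  map π.boundedSeq (π.ultrapower ω).toRepresentation (Ultrapower.mk ω).toAddMonoidHom
    fun _ _ => rfl

theorem eval_comp_ultrapowerMk (F : X ⟶ π.boundedSeq.ratRep) (x : X) :
    eval (F ≫ ultrapowerMk π ω) x = Ultrapower.mk ω (eval F x) := rfl

instance : Epi (ultrapowerMk π ω) :=
  (Rep.epi_iff_surjective _).2 (nullSequences ω V).mkQ_surjective

/-- Evaluation of bounded sequences at an index. -/
noncomputable def boundedSeqEval (n : ℕ) : π.boundedSeq.ratRep ⟶ π.toRepresentation.ratRep :=
  map π.boundedSeq π.toRepresentation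
    { toFun := fun f => f n, map_zero' := rfl, map_add' := fun _ _ => rfl } fun _ _ => rfl

variable {π ω}

theorem exists_comp_ultrapowerMk [Projective X]
    (φ : X ⟶ (π.ultrapower ω).toRepresentation.ratRep) :
    ∃ F : X ⟶ π.boundedSeq.ratRep, F ≫ ultrapowerMk π ω = φ :=
  ⟨Projective.factorThru φ (ultrapowerMk π ω), Projective.factorThru_comp _ _⟩

theorem tendsto_cochainVec_zero_iff {r : ℕ} (s : Fin r → X)
    (f : ℕ → (X ⟶ π.toRepresentation.ratRep)) :
    Tendsto (fun n => cochainVec s (f n)) ω (𝓝 0) ↔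
      ∀ i, Tendsto (fun n => eval (f n) (s i)) ω (𝓝 0) := by
  rw [(PiLp.homeomorph 2 (fun _ : Fin r => V)).isInducing.tendsto_nhds_iff, tendsto_pi_nhds]
  rfl

/-- Finite generation turns a uniform bound on the generators into a bound at each element of `X`,
which is all that bounded sequences require. -/
theorem exists_boundedSeq {r : ℕ} {s : Fin r → X} (hs : IsGenerating s) {C : ℝ}
    (f : ℕ → (X ⟶ π.toRepresentation.ratRep)) (hf : ∀ n, ‖cochainVec s (f n)‖ ≤ C) :
    ∃ F : X ⟶ π.boundedSeq.ratRep, ∀ n, F ≫ boundedSeqEval π n = f n := by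
  have hb (x : X) : ∃ B, ∀ n, ‖eval (f n) x‖ ≤ B := by
    obtain ⟨a, rfl⟩ := hs x
    refine ⟨∑ i, ‖π.groupRingAct (a i)‖ * C, fun n => ?_⟩
    rw [eval_groupRingComb]
    refine norm_sum_le_of_le _ fun i _ => ?_
    refine (ContinuousLinearMap.le_opNorm _ _).trans ?_
    gcongr
    exact (PiLp.norm_apply_le (cochainVec s (f n)) i).trans (hf n)
  choose B hB using hb
  refine ⟨homMk X π.boundedSeq
    { toFun := fun x => BoundedContinuousFunction.ofNormedAddCommGroupDiscrete
        (fun n => eval (f n) x) (B x) (hB x)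
      map_zero' := ?_
      map_add' := fun x y => ?_ } fun g x => ?_, fun n => rfl⟩
  · ext n
    exact map_zero (eval (f n))
  · ext n
    exact map_add (eval (f n)) x y
  · ext n
    exact eval_ρ (f n) g x

variable {P : ChainComplex (Rep.{0} ℚ G) ℕ}

/-- If the coboundary operator on `V` is bounded below in degree `0`, then it is injective in
degree `0` for the ultrapower of `V`. -/
theorem homExact_zero_ultrapower [Projective (P.X 0)] {r r' : ℕ} {s : Fin r → P.X 0}
    (hs : IsGenerating s) (t : Fin r' → P.X 1) {c : ℝ}
    (hc : ∀ f : P.X 0 ⟶ π.toRepresentation.ratRep,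
      ‖cochainVec s f‖ ≤ c * ‖cochainVec t (P.d 1 0 ≫ f)‖) :
    HomExact P (π.ultrapower ω).toRepresentation.ratRep 0 := by
  rw [homExact_zero_iff]
  intro φ hφ
  obtain ⟨F, rfl⟩ := exists_comp_ultrapowerMk φ
  have h1 : Tendsto (fun n => cochainVec t (P.d 1 0 ≫ F ≫ boundedSeqEval π n)) ω (𝓝 0) := by
    rw [tendsto_cochainVec_zero_iff]
    intro i
    refine (Ultrapower.mk_eq_zero_iff ω (f := eval F ((P.d 1 0).hom (t i)))).1 ?_
    rw [← eval_comp_ultrapowerMk, ← eval_comp, hφ]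
    rfl
  have h2 : Tendsto (fun n => cochainVec s (F ≫ boundedSeqEval π n)) ω (𝓝 0) := by
    refine squeeze_zero_norm (fun n => hc _) ?_
    simpa using h1.norm.const_mul c
  rw [tendsto_cochainVec_zero_iff] at h2
  refine cochainVec_injective hs ?_
  ext i
  exact (Ultrapower.mk_eq_zero_iff ω (f := eval F (s i))).2 (h2 i)

/-- If `Hom(P, W)` is exact in degree `n` for the ultrapower `W` of `V`, then the coboundary
operator on `V` is bounded below on the orthogonal complement of the coboundaries. -/
theorem exists_norm_le_of_homExact_ultrapower (hω : (ω : Filter ℕ) ≤ atTop) {n : ℕ}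
    [Projective (P.X (n - 1))] {r r' : ℕ} {s : Fin r → P.X n} {t : Fin r' → P.X (n + 1)}
    (hs : IsGenerating s) (ht : IsGenerating t)
    (h : HomExact P (π.ultrapower ω).toRepresentation.ratRep n) :
    ∃ c : ℝ, ∀ f : P.X n ⟶ π.toRepresentation.ratRep,
      (∀ g : P.X (n - 1) ⟶ π.toRepresentation.ratRep,
        inner ℂ (cochainVec s (P.d n (n - 1) ≫ g)) (cochainVec s f) = 0) →
      ‖cochainVec s f‖ ≤ c * ‖cochainVec t (P.d (n + 1) n ≫ f)‖ := by
  -- Failure for each constant `j + 1` gives, after scaling, unit cochains `f j` orthogonal to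
  -- coboundaries with differential at most `1 / (j + 1)`. Together they form an ultrapower cocycle.
  by_contra! hcon
  have hseq (j : ℕ) : ∃ f : P.X n ⟶ π.toRepresentation.ratRep,
      (∀ g : P.X (n - 1) ⟶ π.toRepresentation.ratRep,
        inner ℂ (cochainVec s (P.d n (n - 1) ≫ g)) (cochainVec s f) = 0) ∧
      ‖cochainVec s f‖ = 1 ∧ ‖cochainVec t (P.d (n + 1) n ≫ f)‖ ≤ 1 / ((j : ℝ) + 1) := by
    obtain ⟨f, hf, hlt⟩ := hcon ((j : ℝ) + 1)
    have hpos : 0 < ‖cochainVec s f‖ := lt_of_le_of_lt (by positivity) hlt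
    refine ⟨smulCochain ((‖cochainVec s f‖⁻¹ : ℝ) : ℂ) f, fun g => ?_, ?_, ?_⟩
    · rw [cochainVec_smulCochain, inner_smul_right, hf, mul_zero]
    · rw [cochainVec_smulCochain, norm_smul, Complex.norm_real, norm_inv, norm_norm]
      exact inv_mul_cancel₀ hpos.ne'
    · rw [comp_smulCochain, cochainVec_smulCochain, norm_smul, Complex.norm_real, norm_inv,
        norm_norm, inv_mul_le_iff₀ hpos, mul_one_div, le_div_iff₀ (by positivity), mul_comm]
      exact hlt.le
  choose f hf hf1 hfd using hseq
  obtain ⟨F, hF⟩ := exists_boundedSeq hs f fun j => (hf1 j).le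
  have hd : Tendsto (fun j => cochainVec t (P.d (n + 1) n ≫ F ≫ boundedSeqEval π j)) ω (𝓝 0) := by
    refine squeeze_zero_norm (fun j => ?_) (tendsto_one_div_add_atTop_nhds_zero_nat.mono_left hω)
    rw [hF]
    exact hfd j
  obtain ⟨ψ, hψ⟩ := h (F ≫ ultrapowerMk π ω) (by
    refine cochainVec_injective ht ?_
    ext i
    exact (Ultrapower.mk_eq_zero_iff ω (f := eval F ((P.d (n + 1) n).hom (t i)))).2
      ((tendsto_cochainVec_zero_iff _ _).1 hd i))
  obtain ⟨Ψ, rfl⟩ := exists_comp_ultrapowerMk ψ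
  have hlim : Tendsto (fun j => cochainVec s
      (f j - P.d n (n - 1) ≫ Ψ ≫ boundedSeqEval π j)) ω (𝓝 0) := by
    rw [tendsto_cochainVec_zero_iff]
    intro i
    have h0 : Ultrapower.mk ω (eval F (s i) - eval Ψ ((P.d n (n - 1)).hom (s i))) = 0 := by
      rw [map_sub, ← eval_comp_ultrapowerMk, ← eval_comp_ultrapowerMk, ← eval_comp, hψ, sub_self]
    refine ((Ultrapower.mk_eq_zero_iff ω).1 h0).congr fun j => ?_
    rw [eval_sub, ← hF j]
    rfl
  -- By Pythagoras, subtracting a coboundary from the unit vector orthogonal to it cannot shorten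
  -- it; this contradicts `hlim`.
  have hge (j : ℕ) : 1 ≤ ‖cochainVec s (f j - P.d n (n - 1) ≫ Ψ ≫ boundedSeqEval π j)‖ := by
    set g := Ψ ≫ boundedSeqEval π j
    have h1 := norm_add_sq_eq_norm_sq_add_norm_sq_of_inner_eq_zero (𝕜 := ℂ)
      (cochainVec s (f j)) (-cochainVec s (P.d n (n - 1) ≫ g)) (by
        rw [inner_neg_right, inner_eq_zero_symm.1 (hf j g), neg_zero])
    rw [← sub_eq_add_neg, ← cochainVec_sub, hf1 j] at h1
    nlinarith [norm_nonneg (cochainVec s (f j - P.d n (n - 1) ≫ g)),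
      norm_nonneg (-cochainVec s (P.d n (n - 1) ≫ g))]
  have := ge_of_tendsto' hlim.norm hge
  rw [norm_zero] at this
  linarith

end UltrapowerCochains

/-! ### Closed range and invariant classes. -/

/-- A bounded operator between Hilbert spaces that is bounded below on the orthogonal complement
of its kernel has closed range. -/
theorem ContinuousLinearMap.isClosed_range_of_norm_le {E F : Type*} [NormedAddCommGroup E]
    [InnerProductSpace ℂ E] [CompleteSpace E] [NormedAddCommGroup F] [NormedSpace ℂ F]
    [CompleteSpace F] (T : E →L[ℂ] F) {c : ℝ}
    (h : ∀ x ∈ (LinearMap.ker T.toLinearMap)ᗮ, ‖x‖ ≤ c * ‖T x‖) : IsClosed (Set.range T) := by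
  have hK : IsClosed (LinearMap.ker T.toLinearMap : Set E) := T.isClosed_ker
  have : CompleteSpace (LinearMap.ker T.toLinearMap) := hK.completeSpace_coe
  let T' : (LinearMap.ker T.toLinearMap)ᗮ →L[ℂ] F :=
    T ∘L (LinearMap.ker T.toLinearMap)ᗮ.subtypeL
  have hanti : AntilipschitzWith (Real.toNNReal c) T' := by
    refine AddMonoidHomClass.antilipschitz_of_bound T' fun x => (h x x.2).trans ?_
    exact mul_le_mul_of_nonneg_right (Real.le_coe_toNNReal c) (norm_nonneg _)
  have hrange : Set.range T = Set.range T' := by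
    refine Set.Subset.antisymm ?_ ?_
    · rintro _ ⟨x, rfl⟩
      obtain ⟨y, hy, z, hz, rfl⟩ := (LinearMap.ker T.toLinearMap).exists_add_mem_mem_orthogonal x
      refine ⟨⟨z, hz⟩, ?_⟩
      have hy0 : T y = 0 := hy
      change T z = T (y + z)
      rw [map_add, hy0, zero_add]
    · rintro _ ⟨x, rfl⟩
      exact ⟨x, rfl⟩
  rw [hrange]
  exact hanti.isClosed_range T'.uniformContinuous

section ClosedRange

open Representation.ratRep Rep Filter Topology

variable {G V : Type} [Group G] [NormedAddCommGroup V] [InnerProductSpace ℂ V] [CompleteSpace V]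
  {π : UnitaryRep G V} {P : ChainComplex (Rep.{0} ℚ G) ℕ}

/-- Exactness in degree `0` makes the first differential injective; in degree `1` it makes its range
the closed space of cocycles. The open mapping theorem then bounds it from below. -/
theorem exists_norm_le_of_homExact_zero_one {r₀ r₁ r₂ : ℕ} {s₀ : Fin r₀ → P.X 0}
    {s₁ : Fin r₁ → P.X 1} {s₂ : Fin r₂ → P.X 2} (hs₀ : IsGenerating s₀) (hs₁ : IsGenerating s₁)
    (hs₂ : IsGenerating s₂) (h₀ : HomExact P π.toRepresentation.ratRep 0)
    (h₁ : HomExact P π.toRepresentation.ratRep 1) :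
    ∃ c : ℝ, ∀ f : P.X 0 ⟶ π.toRepresentation.ratRep,
      ‖cochainVec s₀ f‖ ≤ c * ‖cochainVec s₁ (P.d 1 0 ≫ f)‖ := by
  obtain ⟨D₀, hD₀⟩ := exists_coboundary_operator π (P.d 1 0) hs₀ s₁
  obtain ⟨D₁, hD₁⟩ := exists_coboundary_operator π (P.d 2 1) hs₁ s₂
  have hE := isClosed_cochainSpace (π := π) hs₀
  have : CompleteSpace (cochainSpace π s₀) := hE.completeSpace_coe
  let T := D₀ ∘L (cochainSpace π s₀).subtypeL
  have hT (f : P.X 0 ⟶ π.toRepresentation.ratRep) :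
      T ⟨cochainVec s₀ f, cochainVec_mem s₀ f⟩ = cochainVec s₁ (P.d 1 0 ≫ f) := hD₀ f
  have hinj : Function.Injective T := by
    rw [injective_iff_map_eq_zero]
    rintro ⟨_, f, rfl⟩ hf
    rw [hT] at hf
    have : f = 0 := (homExact_zero_iff P _).1 h₀ f
      (cochainVec_injective hs₁ (hf.trans (cochainVec_zero s₁).symm))
    subst this
    rfl
  have hrange : Set.range T = (cochainSpace π s₁ : Set _) ∩ D₁ ⁻¹' {0} := by
    refine Set.Subset.antisymm ?_ ?_
    · rintro _ ⟨⟨_, f, rfl⟩, rfl⟩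
      rw [hT]
      refine ⟨cochainVec_mem s₁ _, ?_⟩
      rw [Set.mem_preimage, hD₁, ← Category.assoc, P.d_comp_d, Limits.zero_comp]
      rfl
    · rintro _ ⟨⟨f, rfl⟩, hf⟩
      rw [Set.mem_preimage, hD₁] at hf
      obtain ⟨g, rfl⟩ := h₁ f (cochainVec_injective hs₂ hf)
      exact ⟨⟨cochainVec s₀ g, cochainVec_mem s₀ g⟩, hT g⟩
  have hclosed : IsClosed (Set.range T) := by
    rw [hrange]
    exact (isClosed_cochainSpace hs₁).inter (isClosed_singleton.preimage D₁.continuous)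
  obtain ⟨c, hc⟩ := T.antilipschitz_of_injective_of_isClosed_range hinj hclosed
  refine ⟨c, fun f => ?_⟩
  rw [← hT]
  exact ZeroHomClass.bound_of_antilipschitz T hc ⟨cochainVec s₀ f, cochainVec_mem s₀ f⟩

variable (π P) in
/-- The space of coboundaries in degree `n + 1`, identified with their values on a finite
family. -/
noncomputable def coboundarySpace {n r : ℕ} (t : Fin r → P.X (n + 1)) :
    Submodule ℂ (PiLp 2 (fun _ : Fin r => V)) where
  carrier := Set.range fun f : P.X n ⟶ π.toRepresentation.ratRep =>
    cochainVec t (P.d (n + 1) n ≫ f)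
  add_mem' := by
    rintro _ _ ⟨f, rfl⟩ ⟨g, rfl⟩
    refine ⟨f + g, ?_⟩
    change cochainVec t (P.d (n + 1) n ≫ (f + g)) = _
    rw [Preadditive.comp_add]
    rfl
  zero_mem' := ⟨0, by simp only [Limits.comp_zero]; rfl⟩
  smul_mem' := by
    rintro c _ ⟨f, rfl⟩
    refine ⟨smulCochain c f, ?_⟩
    change cochainVec t (P.d (n + 1) n ≫ smulCochain c f) = _
    rw [comp_smulCochain]
    rfl

theorem isClosed_coboundarySpace {n r r' : ℕ} {s : Fin r → P.X n} {t : Fin r' → P.X (n + 1)}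
    (hs : IsGenerating s) {c : ℝ}
    (hc : ∀ f : P.X n ⟶ π.toRepresentation.ratRep,
      (∀ g : P.X (n - 1) ⟶ π.toRepresentation.ratRep,
        inner ℂ (cochainVec s (P.d n (n - 1) ≫ g)) (cochainVec s f) = 0) →
      ‖cochainVec s f‖ ≤ c * ‖cochainVec t (P.d (n + 1) n ≫ f)‖) :
    IsClosed (coboundarySpace π P t : Set (PiLp 2 (fun _ : Fin r' => V))) := by
  obtain ⟨D, hD⟩ := exists_coboundary_operator π (P.d (n + 1) n) hs t
  have hE := isClosed_cochainSpace (π := π) hs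
  have : CompleteSpace (cochainSpace π s) := hE.completeSpace_coe
  let T := D ∘L (cochainSpace π s).subtypeL
  have hT (f : P.X n ⟶ π.toRepresentation.ratRep) :
      T ⟨cochainVec s f, cochainVec_mem s f⟩ = cochainVec t (P.d (n + 1) n ≫ f) := hD f
  have hrange : (coboundarySpace π P t : Set (PiLp 2 (fun _ : Fin r' => V))) = Set.range T := by
    refine Set.Subset.antisymm ?_ ?_
    · rintro _ ⟨f, rfl⟩
      exact ⟨_, hT f⟩
    · rintro _ ⟨⟨_, f, rfl⟩, rfl⟩
      exact ⟨f, (hT f).symm⟩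
  rw [hrange]
  refine T.isClosed_range_of_norm_le (c := c) ?_
  rintro ⟨_, f, rfl⟩ hf
  rw [hT]
  -- Coboundaries lie in the kernel of `T`, so orthogonality to the kernel implies orthogonality to
  -- them.
  refine hc f fun g => hf ⟨_, cochainVec_mem s (P.d n (n - 1) ≫ g)⟩ ?_
  change T _ = 0
  rw [hT, ← Category.assoc, P.d_comp_d, Limits.zero_comp]
  rfl

/-- Reduced cohomology classes fixed by a commuting unitary group without invariant vectors
vanish: if the coboundaries form a closed subspace, then a cochain that is invariant modulo
coboundaries is a coboundary. -/
theorem exists_d_comp_eq_of_isClosed {Γ : Type} [Group Γ] {n r : ℕ} {t : Fin r → P.X (n + 1)}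
    (ht : IsGenerating t)
    (hclosed : IsClosed (coboundarySpace π P t : Set (PiLp 2 (fun _ : Fin r => V))))
    (U : UnitaryRep Γ V) (hU : ∀ γ g v, U γ (π g v) = π g (U γ v))
    (hinv : ∀ v, (∀ γ, U γ v = v) → v = 0)
    (φ : P.X (n + 1) ⟶ π.toRepresentation.ratRep)
    (hφ : ∀ γ, ∃ ψ, P.d (n + 1) n ≫ ψ =
      φ ≫ map π.toRepresentation π.toRepresentation (U.toRepresentation γ).toAddMonoidHom
        (hU γ) - φ) :
    ∃ ψ, P.d (n + 1) n ≫ ψ = φ := by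
  set R := coboundarySpace π P t
  have : CompleteSpace R := hclosed.completeSpace_coe
  let A (γ : Γ) : PiLp 2 (fun _ : Fin r => V) ≃ₗᵢ[ℂ] PiLp 2 (fun _ : Fin r => V) :=
    LinearIsometryEquiv.piLpCongrRight 2 fun _ => U γ
  have hA (γ : Γ) (x : PiLp 2 (fun _ : Fin r => V)) (i : Fin r) : A γ x i = U γ (x i) := rfl
  have hAinv (γ : Γ) (x : PiLp 2 (fun _ : Fin r => V)) : A γ (A γ⁻¹ x) = x := by
    ext i
    change (U γ * U γ⁻¹) (x i) = x i
    rw [← map_mul, mul_inv_cancel, map_one]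
    rfl
  have hAR (γ : Γ) (x) (hx : x ∈ R) : A γ x ∈ R := by
    obtain ⟨f, rfl⟩ := hx
    exact ⟨f ≫ map π.toRepresentation π.toRepresentation (U.toRepresentation γ).toAddMonoidHom
      (hU γ), rfl⟩
  obtain ⟨τ, hτ, η, hη, hx⟩ := R.exists_add_mem_mem_orthogonal (cochainVec t φ)
  have hη0 : η = 0 := by
    ext i
    refine hinv _ fun γ => ?_
    -- Invariance of the class puts this difference in `R`; unitarity and `Γ`-stability of `R` put
    -- it in `Rᗮ`. So `η` is fixed by `Γ`.
    have h1 : A γ η - η ∈ R := by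
      obtain ⟨ψ, hψ⟩ := hφ γ
      have h2 : A γ (cochainVec t φ) - cochainVec t φ ∈ R := by
        refine ⟨ψ, ?_⟩
        change cochainVec t (P.d (n + 1) n ≫ ψ) = _
        rw [hψ]
        rfl
      have h3 := R.sub_mem h2 (R.sub_mem (hAR γ τ hτ) hτ)
      rw [hx, map_add] at h3
      convert h3 using 1
      abel
    have h2 : A γ η - η ∈ Rᗮ := by
      refine Rᗮ.sub_mem (fun y hy => ?_) hη
      rw [← hAinv γ y, LinearIsometryEquiv.inner_map_map]
      exact hη _ (hAR _ _ hy)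
    have h3 : A γ η - η = 0 :=
      inner_self_eq_zero.1 (h2 _ h1)
    rw [← hA, sub_eq_zero.1 h3]
  rw [hη0, add_zero] at hx
  rw [← hx] at hτ
  obtain ⟨ψ, hψ⟩ := hτ
  exact ⟨ψ, cochainVec_injective ht hψ⟩

end ClosedRange

/-! ### Closed coboundaries from `(T_m)`, and the `Γ`-action on resolutions. -/

section Vanishing

open Representation.ratRep Rep

/-- This lets the absence of invariants in the ultrapower be read off from a norm estimate on
cochains of degree `0`. -/
theorem UnitaryRep.noInvariants_iff {G V : Type} [Group G] [NormedAddCommGroup V]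
    [InnerProductSpace ℂ V] (π : UnitaryRep G V)
    (P : ProjectiveResolution (Rep.trivial ℚ G ℚ)) :
    π.NoInvariants ↔ HomExact P.complex π.toRepresentation.ratRep 0 := by
  rw [← subsingleton_groupCohomology_iff_homExact,
    Representation.ratRep.subsingleton_groupCohomology_iff,
    subsingleton_groupCohomology_zero_iff]
  rfl

theorem HigherPropertyT.homExact {G V : Type} [Group G] [NormedAddCommGroup V]
    [InnerProductSpace ℂ V] [CompleteSpace V] {m : ℕ} (hT : HigherPropertyT m G)
    {π : UnitaryRep G V} (hπ : π.NoInvariants) (P : ProjectiveResolution (Rep.trivial ℚ G ℚ))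
    {q : ℕ} (hq : q ≤ m) : HomExact P.complex π.toRepresentation.ratRep q := by
  rcases Nat.eq_zero_or_pos q with rfl | hpos
  · exact (π.noInvariants_iff P).1 hπ
  · rw [← subsingleton_groupCohomology_iff_homExact,
      Representation.ratRep.subsingleton_groupCohomology_iff]
    exact hT V π hπ q hpos hq

/-- Property `(T_m)` and finiteness up to degree `m + 1` imply that the coboundaries in degree
`m + 1` form a closed subspace. -/
theorem HigherPropertyT.exists_isClosed_coboundarySpace {G V : Type} [Group G]
    [NormedAddCommGroup V] [InnerProductSpace ℂ V] [CompleteSpace V] {m : ℕ} (hm : 1 ≤ m)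
    (hT : HigherPropertyT m G) {π : UnitaryRep G V} (hπ : π.NoInvariants)
    (P : ProjectiveResolution (Rep.trivial ℚ G ℚ))
    (hP : ∀ i ≤ m + 1, Module.Finite (MonoidAlgebra ℚ G) (P.complex.X i).ρ.asModule) :
    ∃ (r : ℕ) (t : Fin r → P.complex.X (m + 1)), IsGenerating t ∧
      IsClosed (coboundarySpace π P.complex t : Set (PiLp 2 (fun _ : Fin r => V))) := by
  have gen (i : ℕ) (hi : i ≤ m + 1) :
      ∃ (r : ℕ) (s : Fin r → P.complex.X i), IsGenerating s :=
    have := hP i hi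
    exists_isGenerating
  obtain ⟨r₀, s₀, hs₀⟩ := gen 0 (by omega)
  obtain ⟨r₁, s₁, hs₁⟩ := gen 1 (by omega)
  obtain ⟨r₂, s₂, hs₂⟩ := gen 2 (by omega)
  obtain ⟨r, s, hs⟩ := gen m (by omega)
  obtain ⟨r', t, ht⟩ := gen (m + 1) le_rfl
  have := P.projective 0
  have := P.projective (m - 1)
  obtain ⟨c, hc⟩ := exists_norm_le_of_homExact_zero_one hs₀ hs₁ hs₂
    (hT.homExact hπ P (Nat.zero_le m)) (hT.homExact hπ P hm)
  have hW : (π.ultrapower (Filter.hyperfilter ℕ)).NoInvariants :=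
    (UnitaryRep.noInvariants_iff _ P).2 (homExact_zero_ultrapower hs₀ s₁ hc)
  obtain ⟨c', hc'⟩ := exists_norm_le_of_homExact_ultrapower Nat.hyperfilter_le_atTop hs ht
    (hT.homExact hW P le_rfl)
  exact ⟨r', t, ht, isClosed_coboundarySpace hs hc'⟩

variable {Γ Λ : Type} [Group Γ] [Group Λ]

/-- A projective resolution of the trivial representation of `Γ × Λ`, restricted to `Λ`. -/
noncomputable def resResolution (Q : ProjectiveResolution (Rep.trivial ℚ (Γ × Λ) ℚ)) :
    ProjectiveResolution (Rep.trivial ℚ Λ ℚ) :=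
  (resFunctor (MonoidHom.inr Γ Λ)).mapProjectiveResolution Q

/-- The action of an element of `Γ` on a resolution for `Γ × Λ`, as an endomorphism of its
restriction to `Λ`. -/
noncomputable def resResolutionAct (Q : ProjectiveResolution (Rep.trivial ℚ (Γ × Λ) ℚ)) (γ : Γ) :
    (resResolution Q).complex ⟶ (resResolution Q).complex where
  f n := Rep.ofHom ⟨(Q.complex.X n).ρ (γ, 1), fun l => by
    change (Q.complex.X n).ρ (γ, 1) * (Q.complex.X n).ρ (1, l) =
      (Q.complex.X n).ρ (1, l) * (Q.complex.X n).ρ (γ, 1)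
    rw [← map_mul, ← map_mul]
    simp⟩
  comm' i j _ := by
    refine hom_ext (Representation.IntertwiningMap.ext (LinearMap.ext fun x => ?_))
    exact hom_comm_apply (Q.complex.d i j) (γ, 1) x

/-- `Γ` acts trivially on `ℚ`, so its action on the resolution lifts the identity and is invisible
up to homotopy. -/
theorem resResolutionAct_comp_π (Q : ProjectiveResolution (Rep.trivial ℚ (Γ × Λ) ℚ)) (γ : Γ) :
    resResolutionAct Q γ ≫ (resResolution Q).π = (resResolution Q).π := by
  have h : (resResolutionAct Q γ).f 0 ≫
      (resFunctor (MonoidHom.inr Γ Λ)).map (Q.π.f 0) =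
      (resFunctor (MonoidHom.inr Γ Λ)).map (Q.π.f 0) :=
    hom_ext (Representation.IntertwiningMap.ext (LinearMap.ext fun x =>
      hom_comm_apply (Q.π.f 0) (γ, 1) x))
  refine HomologicalComplex.to_single_hom_ext ?_
  exact (Category.assoc _ _ _).symm.trans (congrArg (· ≫
    ((HomologicalComplex.singleMapHomologicalComplex (resFunctor (MonoidHom.inr Γ Λ)) _ _).hom.app
      (Rep.trivial ℚ (Γ × Λ) ℚ)).f 0) h)

theorem homotopy_comp_eq {C : Type*} [Category C] [Preadditive C] {X Y : ChainComplex C ℕ}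
    {u v : X ⟶ Y} (h : Homotopy u v) {A : C} {n : ℕ} (f : Y.X (n + 1) ⟶ A)
    (hf : Y.d (n + 2) (n + 1) ≫ f = 0) :
    ∃ ψ : X.X n ⟶ A, X.d (n + 1) n ≫ ψ = u.f (n + 1) ≫ f - v.f (n + 1) ≫ f := by
  refine ⟨h.hom n (n + 1) ≫ f, ?_⟩
  have := h.comm (n + 1)
  rw [dNext_eq (i' := n) _ (by simp), prevD_eq (j' := n + 2) _ (by simp)] at this
  rw [this]
  simp [hf]

end Vanishing

/-! ### The vanishing theorem. -/

theorem lemma2 (Γ Λ : Type) [Group Γ] [Group Λ] (hΛ : FinitenessFPInfty Λ)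
    (m : ℕ) (hm : 1 ≤ m) (hT : HigherPropertyT m Λ)
    (V : Type) [NormedAddCommGroup V] [InnerProductSpace ℂ V] [CompleteSpace V]
    (π : UnitaryRep (Γ × Λ) V)
    (hΓV : UnitaryRep.NoInvariants (π.comp (MonoidHom.inl Γ Λ)))
    (hΛV : UnitaryRep.NoInvariants (π.comp (MonoidHom.inr Γ Λ)))
    (k : ℕ) (hk : k ≤ m + 1) :
    Subsingleton (π.cohomology k) := by
  let Q := Rep.barResolution ℚ (Γ × Λ)
  let πΓ : UnitaryRep Γ V := π.comp (MonoidHom.inl Γ Λ)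
  let πΛ : UnitaryRep Λ V := π.comp (MonoidHom.inr Γ Λ)
  have hQ : ∀ n, Projective (Q.complex.X n) := Q.projective
  have hex : ∀ q ≤ m, HomExact (Rep.resComplex Q.complex)
      (Rep.res (MonoidHom.inr Γ Λ) π.toRepresentation.ratRep) q :=
    fun q hq => hT.homExact hΛV (resResolution Q) hq
  rw [UnitaryRep.cohomology, ← Representation.ratRep.subsingleton_groupCohomology_iff,
    subsingleton_groupCohomology_iff_homExact _ _ Q]
  rcases hk.lt_or_eq with hlt | rfl
  · exact Rep.homExact_of_res hQ k _ fun q hq => hex q (by omega)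
  intro f hf
  -- In the top degree it suffices to find a primitive over `Λ`; it is sought on the finitely
  -- generated resolution `P`.
  refine Rep.exists_d_comp_eq_of_res hQ m _ hex f ?_
  obtain ⟨P, hP⟩ := hΛ (m + 1)
  obtain ⟨r, t, ht, hclosed⟩ := hT.exists_isClosed_coboundarySpace hm hΛV P hP
  let e := ProjectiveResolution.homotopyEquiv (resResolution Q) P
  let f' : (resResolution Q).complex.X (m + 1) ⟶ πΛ.toRepresentation.ratRep :=
    (Rep.resFunctor (MonoidHom.inr Γ Λ)).map f
  have hf' : (resResolution Q).complex.d (m + 2) (m + 1) ≫ f' = 0 := by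
    change (Rep.resFunctor (MonoidHom.inr Γ Λ)).map (Q.complex.d (m + 2) (m + 1)) ≫
      (Rep.resFunctor (MonoidHom.inr Γ Λ)).map f = 0
    rw [← Functor.map_comp, hf, Functor.map_zero]
  have hU (γ : Γ) (l : Λ) (v : V) : πΓ γ (πΛ l v) =
      πΛ l (πΓ γ v) := by
    change (π (γ, 1) * π (1, l)) v = (π (1, l) * π (γ, 1)) v
    rw [← map_mul, ← map_mul]
    simp
  have hinv (v : V) (hv : ∀ γ, πΓ γ v = v) : v = 0 := by
    have : v ∈ πΓ.toRepresentation.invariants := hv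
    rwa [show πΓ.toRepresentation.invariants = ⊥ from hΓV] at this
  have hπ : e.inv ≫ (resResolution Q).π = P.π :=
    ProjectiveResolution.homotopyEquiv_inv_π (resResolution Q) P
  obtain ⟨ψ, hψ⟩ := exists_d_comp_eq_of_isClosed ht hclosed πΓ hU hinv
    (e.inv.f (m + 1) ≫ f') fun γ => by
      -- Both maps lift the identity of `ℚ`. By equivariance of `f`, acting by `γ` on the resolution
      -- equals acting by `γ` on the values, so the class is `Γ`-invariant.
      have hh : Homotopy (e.inv ≫ resResolutionAct Q γ) e.inv :=
        ProjectiveResolution.liftHomotopy (𝟙 _) (e.inv ≫ resResolutionAct Q γ) e.inv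
          (by
            rw [CategoryTheory.Functor.map_id, Category.comp_id, ← hπ, Category.assoc]
            rw [resResolutionAct_comp_π])
          (by rw [CategoryTheory.Functor.map_id, Category.comp_id, hπ])
      obtain ⟨ψ, hψ⟩ := homotopy_comp_eq hh f' hf'
      refine ⟨ψ, hψ.trans ?_⟩
      refine congrArg (· - e.inv.f (m + 1) ≫ f') ?_
      refine Rep.hom_ext (Representation.IntertwiningMap.ext (LinearMap.ext fun x => ?_))
      exact Rep.hom_comm_apply f (γ, 1) _
  obtain ⟨χ, hχ⟩ := homotopy_comp_eq e.homotopyHomInvId f' hf'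
  -- Pulling `ψ` back along `e.hom` gives a primitive of the round trip of `f'`; `χ` corrects for
  -- the homotopy from the round trip to the identity.
  refine ⟨e.hom.f m ≫ ψ - χ, ?_⟩
  change (resResolution Q).complex.d (m + 1) m ≫ (e.hom.f m ≫ ψ - χ) = f'
  rw [Preadditive.comp_sub, hχ, ← Category.assoc, ← e.hom.comm, Category.assoc, hψ]
  simp
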